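/- A quandle is a set $X$ with a binary operation $*$ such that $a*a=a$ for all $a$, each map $x\mapsto x*b$ is a bijection of $X$, and $(a*b)*c=(a*c)*(b*c)$ for all $a,b,c$. A quandle, or a subquandle, is called trivial if $a*b=a$ for all its elements $a,b$. For $m\in\mathbb{N}$, a quandle $X$ is $m$-almost quasigroup if for every $a\in X$ the stabilizer set $S_a=\{x\in X : a*x=a\}$ has exactly $m$ elements and for every $b\in X\setminus S_a$ the equation $a*x=b$ has a unique solution $x\in X$. The rack chain group $C_n^R(X)=\mathbb{Z}X^n$, $n\ge 0$, is the free abelian group on $n$-tuples of elements of $X$, and $\partial_n:C_n^R(X)\to C_{n-1}^R(X)$ is given by $$\partial_n(x_1,\dots,x_n)=\sum_{i=1}^n(-1)^i\big[(x_1,\dots,x_{i-1},x_{i+1},\dots,x_n)-(x_1*x_i,\dots,x_{i-1}*x_i,x_{i+1},\dots,x_n)\big].$$ Let $C_n^D(X)$ be the subgroup generated by the tuples with $x_i=x_{i+1}$ for some $i$, and let $C_n^Q(X)=C_n^R(X)/C_n^D(X)$. The reduced quandle homology $\widetilde H_n^Q(X)$ is the homology of the augmented quandle chain complex $$\cdots\to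 C_3^Q(X)\xrightarrow{\partial_3}C_2^Q(X)\xrightarrow{\partial_2}C_1^Q(X)\xrightarrow{\varepsilon}C_0^Q(X)=\mathbb{Z}\to 0,\qquad \varepsilon(x)=1 \text{ for all } x\in X,$$ in which $\partial_1=0$ is replaced by the augmentation $\varepsilon$. Corollary 3.3. Let $X$ be a finite $m$-almost quasigroup quandle such that for every $a\in X$ the stabilizer set $S_a$ is a trivial subquandle of $X$. If $X$ is not a trivial quandle, then its reduced quandle homology is annihilated by $N=m\cdot\operatorname{lcm}(|X|,|X|-m)$, i.e. $N\,\widetilde H_n^Q(X)=0$ for all $n\ge 0$. -/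

import Mathlib

namespace QuandleHomology

universe u

section Basic

variable {X : Type u}

/-- The quandle operation `x * y` in right-action notation. Mathlib's `Quandle` is written with
left actions, and `x * y` is `Shelf.act y x`: thus `x * x = x`, right multiplication by `y` is
bijective, and `(x * y) * z = (x * z) * (y * z)`. -/
abbrev op [Shelf X] (x y : X) : X := Shelf.act y x

/-- The inverse operation: `(x * y) /* y = x = (x /* y) * y`. -/
abbrev invOp [Rack X] (x y : X) : X := Rack.invAct y x

/-- A trivial quandle is one with `a * b = a` for all `a`, `b`. -/
def IsTrivialQuandle (X : Type u) [Quandle X] : Prop := ∀ a b : X, op a b = a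

/-- A subquandle is a subset that is closed under the operation and the inverse operation. -/
def IsSubquandle [Quandle X] (S : Set X) : Prop :=
  ∀ a ∈ S, ∀ b ∈ S, op a b ∈ S ∧ invOp a b ∈ S

/-- A subquandle that is, as a quandle, trivial. -/
def IsTrivialSubquandle [Quandle X] (S : Set X) : Prop :=
  IsSubquandle S ∧ ∀ a ∈ S, ∀ b ∈ S, op a b = a

/-- The stabilizer set `S_a = {x | a * x = a}`. -/
def stabilizerSet [Quandle X] (a : X) : Set X := {x | op a x = a}

/-- `m`-almost quasigroup quandles: every stabilizer set `S_a` has exactly `m` elements, and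
for `b ∉ S_a` the equation `a * x = b` has a unique solution. -/
structure IsAlmostQuasigroup (X : Type u) [Quandle X] (m : ℕ) : Prop where
  encard_stabilizerSet : ∀ a : X, (stabilizerSet a).encard = m
  existsUnique_solution : ∀ a b : X, b ∉ stabilizerSet a → ∃! x : X, op a x = b

end Basic

section Chains

variable (X : Type u)

/-- The group of rack chains: the free abelian group on the `n`-tuples of elements of `X`. -/
abbrev RackChain (n : ℕ) : Type u := (Fin n → X) →₀ ℤ

variable {X}

/-- The face map that deletes the entry with index `i`. -/
def face₀ {n : ℕ} (i : Fin (n + 1)) (x : Fin (n + 1) → X) : Fin n → X :=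
  fun j => x (i.succAbove j)

/-- The face map that deletes the entry `x i` and lets it act on all entries before it:
`(x₁ * xᵢ, …, xᵢ₋₁ * xᵢ, xᵢ₊₁, …)`. -/
def face [Shelf X] {n : ℕ} (i : Fin (n + 1)) (x : Fin (n + 1) → X) : Fin n → X :=
  fun j => if j.castSucc < i then op (x j.castSucc) (x i) else x j.succ

variable (X)

/-- The linear extension of `x ↦ face₀ i x - face i x`. -/
noncomputable def faceDiff [Shelf X] {n : ℕ} (i : Fin (n + 1)) :
    RackChain X (n + 1) →ₗ[ℤ] RackChain X n :=
  Finsupp.lmapDomain ℤ ℤ (face₀ i) - Finsupp.lmapDomain ℤ ℤ (face i)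

/-- The boundary `∂ₙ₊₁` of the rack complex. The sign is `(-1)^i` for the entry with number `i`
counted from `1`, that is `(-1)^(i + 1)` for the index `i : Fin (n + 1)`. -/
noncomputable def rackBoundary [Shelf X] (n : ℕ) : RackChain X (n + 1) →ₗ[ℤ] RackChain X n :=
  ∑ i : Fin (n + 1), (-1 : ℤ) ^ (i.val + 1) • faceDiff X i

/-- The augmentation `C₁ → C₀ = ℤ`, with `(x) ↦ 1`; here `C₀` is free on the empty tuple. -/
noncomputable def augmentation : RackChain X 1 →ₗ[ℤ] RackChain X 0 :=
  Finsupp.lmapDomain ℤ ℤ (fun _ => Fin.elim0)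

/-- The boundary of the augmented (reduced) rack complex: in degree `1` the rack boundary, which
is zero, is replaced by the augmentation; all other degrees are unchanged. -/
noncomputable def reducedBoundary [Shelf X] :
    (n : ℕ) → RackChain X (n + 1) →ₗ[ℤ] RackChain X n
  | 0 => augmentation X
  | n + 1 => rackBoundary X (n + 1)

/-- The degenerate chains: the subgroup generated by the tuples with two equal
consecutive entries. -/
noncomputable def degenerate (n : ℕ) : Submodule ℤ (RackChain X n) :=
  Submodule.span ℤ {c | ∃ x : Fin n → X,
    (∃ i j : Fin n, j.val = i.val + 1 ∧ x i = x j) ∧ c = Finsupp.single x 1}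

/-- The group of quandle chains. -/
noncomputable abbrev QuandleChain (n : ℕ) : Type u := RackChain X n ⧸ degenerate X n

variable {X}

theorem faceDiff_single [Shelf X] {n : ℕ} (i : Fin (n + 1)) (x : Fin (n + 1) → X) (c : ℤ) :
    faceDiff X i (Finsupp.single x c) =
      Finsupp.single (face₀ i x) c - Finsupp.single (face i x) c := by
  simp [faceDiff, Finsupp.lmapDomain_apply, Finsupp.mapDomain_single]

theorem face₀_apply {n : ℕ} (i : Fin (n + 1)) (x : Fin (n + 1) → X) (j : Fin n) :
    face₀ i x j = if j.castSucc < i then x j.castSucc else x j.succ := by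
  simp only [face₀, Fin.succAbove]
  split_ifs <;> rfl

theorem faces_comm [Rack X] {n : ℕ} {i j : Fin (n + 1)} (h : i ≤ j) (x : Fin (n + 2) → X) :
    face₀ i (face₀ j.succ x) = face₀ j (face₀ i.castSucc x) ∧
    face₀ i (face j.succ x) = face j (face₀ i.castSucc x) ∧
    face i (face₀ j.succ x) = face₀ j (face i.castSucc x) ∧
    face i (face j.succ x) = face j (face i.castSucc x) := by
  obtain ⟨i, hi⟩ := i
  obtain ⟨j, hj⟩ := j
  have h' : i ≤ j := h
  refine ⟨?_, ?_, ?_, ?_⟩ <;> funext ⟨k, hk⟩ <;>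
    simp only [face₀_apply, face, Fin.lt_def, Fin.castSucc_mk, Fin.succ_mk, op] <;>
    split_ifs <;> first | rfl | omega | exact Shelf.self_distrib.symm

theorem faceDiff_comp [Rack X] {n : ℕ} {i j : Fin (n + 1)} (h : i ≤ j) :
    faceDiff X i ∘ₗ faceDiff X j.succ = faceDiff X j ∘ₗ faceDiff X i.castSucc := by
  refine Finsupp.lhom_ext fun x c => ?_
  obtain ⟨h1, h2, h3, h4⟩ := faces_comm h x
  simp only [LinearMap.comp_apply, faceDiff_single, map_sub, h1, h2, h3, h4]
  abel

theorem rackBoundary_comp [Rack X] (n : ℕ) :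
    rackBoundary X n ∘ₗ rackBoundary X (n + 1) = 0 := by
  refine LinearMap.ext fun c => ?_
  simp only [rackBoundary, LinearMap.comp_apply, LinearMap.sum_apply, LinearMap.smul_apply,
    map_sum, map_smul, Finset.smul_sum, smul_smul, LinearMap.zero_apply]
  rw [Finset.sum_comm, ← Finset.sum_product']
  let P := Fin (n + 1) × Fin (n + 2)
  let S : Finset P := {ij : P | ij.1.val < ij.2.val}
  rw [Finset.univ_product_univ, ← Finset.sum_add_sum_compl S, ← eq_neg_iff_add_eq_zero,
    ← Finset.sum_neg_distrib]
  let φ : ∀ ij : P, ij ∈ S → P := fun ij hij =>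
    (ij.2.pred (by
      rintro h
      have : ij.1.val < ij.2.val := by simpa [S] using hij
      simp [h] at this), ij.1.castSucc)
  refine Finset.sum_bij φ ?_ ?_ ?_ ?_
  · rintro ⟨i, j⟩ hij
    simp only [S, Finset.mem_filter, Finset.mem_univ, true_and] at hij
    simp only [S, φ, Finset.mem_compl, Finset.mem_filter, Finset.mem_univ, true_and,
      Fin.val_castSucc, Fin.val_pred]
    omega
  · rintro ⟨i, j⟩ hij ⟨i', j'⟩ hij' h
    simp only [S, Finset.mem_filter, Finset.mem_univ, true_and] at hij hij'
    have h1 : j.val - 1 = j'.val - 1 := congrArg (fun p : P => p.1.val) h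
    have h2 : i.val = i'.val := congrArg (fun p : P => p.2.val) h
    exact Prod.ext (Fin.ext h2) (Fin.ext (by dsimp only; omega))
  · rintro ⟨i, j⟩ hij
    simp only [S, Finset.mem_compl, Finset.mem_filter, Finset.mem_univ, true_and, not_lt] at hij
    refine ⟨(⟨j.val, by omega⟩, i.succ), ?_, ?_⟩
    · simp only [S, Finset.mem_filter, Finset.mem_univ, true_and, Fin.val_succ]
      omega
    · simp [φ]
  · rintro ⟨i, j⟩ hij
    simp only [S, Finset.mem_filter, Finset.mem_univ, true_and] at hij
    obtain ⟨j, rfl⟩ := Fin.exists_succ_eq.mpr (show j ≠ 0 by rintro rfl; simp at hij)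
    have hle : i ≤ j := by
      rw [Fin.le_def]; simp only [Fin.val_succ] at hij; omega
    simp only [φ, Fin.pred_succ, Fin.val_succ, Fin.val_castSucc, ← neg_smul]
    rw [← LinearMap.comp_apply, faceDiff_comp hle, LinearMap.comp_apply]
    congr 1
    ring

theorem reducedBoundary_comp [Rack X] (n : ℕ) :
    reducedBoundary X n ∘ₗ reducedBoundary X (n + 1) = 0 := by
  cases n with
  | succ n => exact rackBoundary_comp (n + 1)
  | zero =>
    refine Finsupp.lhom_ext fun x c => ?_
    have h : ∀ y z : Fin 1 → X, augmentation X (Finsupp.single y c - Finsupp.single z c) = 0 := by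
      intro y z
      rw [map_sub]
      simp [augmentation, Finsupp.lmapDomain_apply, Finsupp.mapDomain_single]
    simp [reducedBoundary, rackBoundary, Fin.sum_univ_two, faceDiff_single, h]

theorem single_mem_degenerate {n : ℕ} {x : Fin n → X} (i j : Fin n) (hij : j.val = i.val + 1)
    (hx : x i = x j) : Finsupp.single x (1 : ℤ) ∈ degenerate X n :=
  Submodule.subset_span ⟨x, ⟨i, j, hij, hx⟩, rfl⟩

theorem degenerate_one : degenerate X 1 = ⊥ := by
  rw [degenerate, Submodule.span_eq_bot]
  rintro _ ⟨x, ⟨i, j, hij, -⟩, -⟩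
  omega

theorem rackBoundary_degenerate [Quandle X] (n : ℕ) :
    degenerate X (n + 1) ≤ (degenerate X n).comap (rackBoundary X n) := by
  rw [degenerate, Submodule.span_le]
  rintro _ ⟨x, ⟨k, l, hkl, hx⟩, rfl⟩
  rw [SetLike.mem_coe, Submodule.mem_comap]
  have hne : k ≠ l := by rintro rfl; omega
  have key : ∀ i, i ≠ k ∧ i ≠ l →
      faceDiff X i (Finsupp.single x 1) ∈ degenerate X n := by
    rintro i ⟨hik, hil⟩
    rw [faceDiff_single]
    rw [Ne, Fin.ext_iff] at hik hil
    rcases lt_or_gt_of_ne hik with h | h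
    · have e1 : (⟨k.val - 1, by omega⟩ : Fin n).succ = k := Fin.ext (by simp; omega)
      have e2 : (⟨k.val, by omega⟩ : Fin n).succ = l := Fin.ext (by simp; omega)
      refine Submodule.sub_mem _ ?_ ?_ <;>
        refine single_mem_degenerate ⟨k.val - 1, by omega⟩ ⟨k.val, by omega⟩
          (by simp; omega) ?_
      · rw [face₀_apply, face₀_apply, if_neg, if_neg, e1, e2, hx] <;>
          simp only [Fin.lt_def, Fin.val_castSucc] <;> omega
      · rw [face, if_neg, face, if_neg, e1, e2, hx] <;>
          simp only [Fin.lt_def, Fin.val_castSucc] <;> omega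
    · have e1 : (⟨k.val, by omega⟩ : Fin n).castSucc = k := Fin.ext (by simp)
      have e2 : (⟨k.val + 1, by omega⟩ : Fin n).castSucc = l := Fin.ext (by simp; omega)
      refine Submodule.sub_mem _ ?_ ?_ <;>
        refine single_mem_degenerate ⟨k.val, by omega⟩ ⟨k.val + 1, by omega⟩ rfl ?_
      · rw [face₀_apply, face₀_apply, if_pos, if_pos, e1, e2, hx] <;>
          simp only [Fin.lt_def, Fin.val_castSucc] <;> omega
      · rw [face, if_pos, face, if_pos, e1, e2, hx] <;>
          simp only [Fin.lt_def, Fin.val_castSucc] <;> omega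
  have hface₀ : face₀ k x = face₀ l x := by
    funext ⟨j, hj⟩
    rw [face₀_apply, face₀_apply]
    simp only [Fin.lt_def, Fin.val_castSucc]
    split_ifs with h1 h2 h2
    · rfl
    · omega
    · have e1 : (⟨j, hj⟩ : Fin n).castSucc = k := Fin.ext (by simp; omega)
      have e2 : (⟨j, hj⟩ : Fin n).succ = l := Fin.ext (by simp; omega)
      rw [e1, e2, hx]
    · rfl
  have hface : face k x = face l x := by
    funext ⟨j, hj⟩
    simp only [face, Fin.lt_def, Fin.val_castSucc]
    split_ifs with h1 h2 h2
    · rw [hx]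
    · omega
    · have e1 : (⟨j, hj⟩ : Fin n).castSucc = k := Fin.ext (by simp; omega)
      have e2 : (⟨j, hj⟩ : Fin n).succ = l := Fin.ext (by simp; omega)
      rw [e1, e2, hx, op, Quandle.fix]
    · rfl
  have hkleq : faceDiff X k (Finsupp.single x 1) = faceDiff X l (Finsupp.single x 1) := by
    rw [faceDiff_single, faceDiff_single, hface₀, hface]
  simp only [rackBoundary, LinearMap.sum_apply, LinearMap.smul_apply]
  rw [← Finset.add_sum_erase _ _ (Finset.mem_univ k),
    ← Finset.add_sum_erase _ _ (Finset.mem_erase.mpr ⟨hne.symm, Finset.mem_univ l⟩), ← add_assoc]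
  refine Submodule.add_mem _ ?_ (Submodule.sum_mem _ fun i hi => ?_)
  · rw [hkleq, hkl, pow_succ _ (k.val + 1), mul_neg_one, neg_smul, add_neg_cancel]
    exact Submodule.zero_mem _
  · simp only [Finset.mem_erase, Finset.mem_univ, and_true] at hi
    exact Submodule.smul_mem _ _ (key i ⟨hi.2, hi.1⟩)

theorem reducedBoundary_degenerate [Quandle X] (n : ℕ) :
    degenerate X (n + 1) ≤ (degenerate X n).comap (reducedBoundary X n) := by
  cases n with
  | zero => rw [degenerate_one]; exact bot_le
  | succ n => exact rackBoundary_degenerate (n + 1)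

end Chains

section Complex

variable (X : Type u) [Quandle X]

/-- The boundary induced by `reducedBoundary` on quandle chains. -/
noncomputable def reducedQuandleBoundary (n : ℕ) :
    QuandleChain X (n + 1) →ₗ[ℤ] QuandleChain X n :=
  Submodule.mapQ _ _ (reducedBoundary X n) (reducedBoundary_degenerate n)

theorem reducedQuandleBoundary_comp (n : ℕ) :
    reducedQuandleBoundary X n ∘ₗ reducedQuandleBoundary X (n + 1) = 0 := by
  refine Submodule.linearMap_qext _ (LinearMap.ext fun c => ?_)
  have h := LinearMap.congr_fun (reducedBoundary_comp (X := X) n) c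
  simp only [LinearMap.comp_apply, LinearMap.zero_apply] at h
  simp [reducedQuandleBoundary, h]

/-- The augmented quandle chain complex
`⋯ → C₂ → C₁ → C₀ = ℤ` (quandle chains, with the augmentation as the last map), whose homology is
the reduced quandle homology of `X`. -/
noncomputable def reducedQuandleComplex : ChainComplex (ModuleCat.{u} ℤ) ℕ :=
  ChainComplex.of (fun n => ModuleCat.of ℤ (QuandleChain X n))
    (fun n => ModuleCat.ofHom (reducedQuandleBoundary X n))
    (fun n => by
      rw [← ModuleCat.ofHom_comp, reducedQuandleBoundary_comp]
      rfl)

theorem reducedQuandleComplex_d (n : ℕ) :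
    (reducedQuandleComplex X).d (n + 1) n = ModuleCat.ofHom (reducedQuandleBoundary X n) :=
  ChainComplex.of_d (X := fun n => ModuleCat.of ℤ (QuandleChain X n))
    (d := fun n => ModuleCat.ofHom (reducedQuandleBoundary X n)) n

/-- The reduced quandle homology groups (with integer coefficients). -/
noncomputable abbrev ReducedQuandleHomology (n : ℕ) : ModuleCat.{u} ℤ :=
  (reducedQuandleComplex X).homology n

end Complex

end QuandleHomology

/-!
Write `k = |X|` and let `J (a, t) = ∑ y, (a, y, t)`. In the rack complex `J` is a chain homotopy
from `A` to `k - m + S`, where `A` replaces the first entry of a tuple by the sum of all elements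
of `X` and `S` replaces it by the sum over its stabilizer set. The stabilizer sets are the classes
of an equivalence relation, so `S * S = m * S` and `A * S = m * A`, hence
`(k - m + S - A) * (k - S) = (k - m) * (k - A)`, and `J * (k - S)` is a homotopy from
`(k - m) * A` to `(k - m) * k`. Let `R` replace the first entry by the second one. Its values are
degenerate, so that `1 - R` is the identity on quandle chains, and `A * (1 - R) = 0` because `A`
forgets the first entry. Thus `J * (k - S) * (1 - R)` contracts the multiplication by `k * (k - m)`;
in degree one the correction `R` is not needed, since there `A` factors through the augmentation.
Finally, `k * (k - m)` divides `m * lcm k (k - m)` because `gcd k (k - m)` divides `m`.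
-/

namespace QuandleHomology

open Finset

section Stabilizers

variable {X : Type*} [Quandle X]

theorem self_mem_stabilizerSet (a : X) : a ∈ stabilizerSet a :=
  Quandle.fix

theorem stabilizerSet_eq_of_mem (hS : ∀ a : X, IsTrivialSubquandle (stabilizerSet a)) {a z : X}
    (hz : z ∈ stabilizerSet a) : stabilizerSet z = stabilizerSet a := by
  have subset_of_mem {b c : X} (hc : c ∈ stabilizerSet b) : stabilizerSet b ⊆ stabilizerSet c :=
    fun d hd => (hS b).2 c hc d hd
  exact (subset_of_mem (subset_of_mem hz (self_mem_stabilizerSet a))).antisymm (subset_of_mem hz)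

theorem IsAlmostQuasigroup.bijOn_op [Finite X] {m : ℕ} (hX : IsAlmostQuasigroup X m) (a : X) :
    Set.BijOn (op a) (stabilizerSet a)ᶜ (stabilizerSet a)ᶜ := by
  have subset_image : (stabilizerSet a)ᶜ ⊆ op a '' (stabilizerSet a)ᶜ := by
    intro b hb
    obtain ⟨x, rfl, -⟩ := hX.existsUnique_solution a b hb
    refine ⟨x, fun hx => hb ?_, rfl⟩
    rw [show op a x = a from hx]
    exact self_mem_stabilizerSet a
  have image_eq : op a '' (stabilizerSet a)ᶜ = (stabilizerSet a)ᶜ :=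
    (Set.eq_of_subset_of_ncard_le subset_image Set.ncard_image_le).symm
  have injOn : Set.InjOn (op a) (stabilizerSet a)ᶜ :=
    Set.injOn_of_ncard_image_eq (by rw [image_eq])
  simpa only [image_eq] using injOn.bijOn_image

theorem IsAlmostQuasigroup.le_card [Finite X] [Nonempty X] {m : ℕ}
    (hX : IsAlmostQuasigroup X m) : m ≤ Nat.card X := by
  obtain ⟨a⟩ := ‹Nonempty X›
  have h : (stabilizerSet a).ncard = m := by
    rw [Set.ncard, hX.encard_stabilizerSet, ENat.toNat_natCast]
  exact h ▸ Set.ncard_le_card _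

variable [Fintype X] [DecidableEq X]

/-- The stabilizer set `S_a` as a finite set, for summation over it. -/
def stabilizerFinset (a : X) : Finset X := {x | op a x = a}

@[simp]
theorem coe_stabilizerFinset (a : X) : (stabilizerFinset a : Set X) = stabilizerSet a := by
  simp [stabilizerFinset, stabilizerSet]

theorem stabilizerFinset_op (a c : X) :
    stabilizerFinset (op a c) = (stabilizerFinset a).map (Rack.act' c).toEmbedding := by
  ext x
  obtain ⟨z, rfl⟩ := (Rack.act' c).surjective x
  have : op (op a c) (op z c) = op a c ↔ op a z = a := by
    rw [op, ← Shelf.self_distrib, Rack.left_cancel]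
  simpa [stabilizerFinset] using this

theorem stabilizerFinset_eq_of_mem (hS : ∀ a : X, IsTrivialSubquandle (stabilizerSet a))
    (a : X) : ∀ z ∈ stabilizerFinset a, stabilizerFinset z = stabilizerFinset a := by
  intro z hz
  rw [← mem_coe, coe_stabilizerFinset] at hz
  rw [← coe_inj, coe_stabilizerFinset, coe_stabilizerFinset, stabilizerSet_eq_of_mem hS hz]

theorem IsAlmostQuasigroup.card_stabilizerFinset {m : ℕ} (hX : IsAlmostQuasigroup X m) (a : X) :
    #(stabilizerFinset a) = m := by
  have h := hX.encard_stabilizerSet a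
  rwa [← coe_stabilizerFinset, Set.encard_coe_eq_coe_finsetCard, Nat.cast_inj] at h

theorem IsAlmostQuasigroup.sum_op {M : Type*} [AddCommGroup M] {m : ℕ}
    (hX : IsAlmostQuasigroup X m) (a : X) (f : X → M) :
    ∑ y, f (op a y) = m • f a + ∑ y, f y - ∑ z ∈ stabilizerFinset a, f z := by
  have on_stabilizer : ∑ y ∈ stabilizerFinset a, f (op a y) = m • f a := by
    rw [← hX.card_stabilizerFinset a, ← sum_const]
    exact sum_congr rfl fun y hy => congrArg f (mem_filter.1 hy).2
  have off_stabilizer :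
      ∑ y ∈ (stabilizerFinset a)ᶜ, f (op a y) = ∑ y ∈ (stabilizerFinset a)ᶜ, f y := by
    have h : Set.BijOn (op a) ↑(stabilizerFinset a)ᶜ ↑(stabilizerFinset a)ᶜ := by
      simpa using hX.bijOn_op a
    exact sum_nbij (op a) h.mapsTo h.injOn h.surjOn fun _ _ => rfl
  rw [← sum_add_sum_compl (stabilizerFinset a), on_stabilizer, off_stabilizer,
    ← sum_add_sum_compl (stabilizerFinset a) f]
  abel

end Stabilizers

section ConsChain

variable {X : Type*} {n : ℕ}

theorem face₀_zero_cons (a : X) (t : Fin n → X) :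
    face₀ 0 (Fin.cons a t : Fin (n + 1) → X) = t :=
  rfl

theorem face_zero_cons [Shelf X] (a : X) (t : Fin n → X) :
    face 0 (Fin.cons a t : Fin (n + 1) → X) = t := by
  funext j
  simp [face]

theorem face₀_succ_cons (i : Fin (n + 1)) (a : X) (t : Fin (n + 1) → X) :
    face₀ i.succ (Fin.cons a t : Fin (n + 2) → X) = Fin.cons a (face₀ i t) := by
  funext j
  cases j using Fin.cases <;> simp [face₀]

theorem face_succ_cons [Shelf X] (i : Fin (n + 1)) (a : X) (t : Fin (n + 1) → X) :
    face i.succ (Fin.cons a t : Fin (n + 2) → X) = Fin.cons (op a (t i)) (face i t) := by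
  funext j
  cases j using Fin.cases with
  | zero => simp [face]
  | succ j => simp only [face, Fin.cons_succ, ← Fin.succ_castSucc, Fin.succ_lt_succ_iff]

/-- The generator of the rack chains given by the tuple with first entry `a` and remaining
entries `t`. -/
noncomputable def consChain (a : X) (t : Fin n → X) : RackChain X (n + 1) :=
  Finsupp.single (Fin.cons a t) 1

theorem rackChain_hom_ext {M : Type*} [AddCommGroup M] {f g : RackChain X (n + 1) →ₗ[ℤ] M}
    (h : ∀ a t, f (consChain a t) = g (consChain a t)) : f = g := by
  refine Finsupp.lhom_ext' fun x => LinearMap.ext_ring ?_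
  have eq_on_cons := h (x 0) (Fin.tail x)
  rwa [consChain, Fin.cons_self_tail] at eq_on_cons

theorem augmentation_consChain (a : X) (t : Fin 0 → X) :
    augmentation X (consChain a t) = Finsupp.single t 1 := by
  simp only [augmentation, consChain, Finsupp.lmapDomain_apply, Finsupp.mapDomain_single,
    Subsingleton.elim _ t]

theorem rackBoundary_consChain [Shelf X] (a : X) (t : Fin (n + 1) → X) :
    rackBoundary X (n + 1) (consChain a t) = ∑ i : Fin (n + 1), (-1 : ℤ) ^ i.val •
      (consChain a (face₀ i t) - consChain (op a (t i)) (face i t)) := by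
  simp only [rackBoundary, LinearMap.sum_apply, LinearMap.smul_apply, consChain]
  rw [Fin.sum_univ_succ]
  simp only [faceDiff_single, face₀_zero_cons, face_zero_cons, face₀_succ_cons, face_succ_cons,
    sub_self, smul_zero, zero_add, Fin.val_succ, pow_succ, mul_neg_one, neg_neg]

theorem rackBoundary_consChain_cons [Shelf X] (a b : X) (t : Fin (n + 1) → X) :
    rackBoundary X (n + 2) (consChain a (Fin.cons b t)) =
      consChain a t - consChain (op a b) t - ∑ i : Fin (n + 1), (-1 : ℤ) ^ i.val •
        (consChain a (Fin.cons b (face₀ i t)) -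
          consChain (op a (t i)) (Fin.cons (op b (t i)) (face i t))) := by
  rw [rackBoundary_consChain, Fin.sum_univ_succ]
  simp only [face₀_zero_cons, face_zero_cons, face₀_succ_cons, face_succ_cons, Fin.cons_zero,
    Fin.cons_succ, Fin.val_zero, pow_zero, one_smul, Fin.val_succ, pow_succ, mul_neg_one, neg_smul,
    sum_neg_distrib, ← sub_eq_add_neg]

theorem rackBoundary_one_consChain_cons [Shelf X] (a b : X) (t : Fin 0 → X) :
    rackBoundary X 1 (consChain a (Fin.cons b t)) = consChain a t - consChain (op a b) t := by
  simp [rackBoundary_consChain, face₀_zero_cons, face_zero_cons]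

theorem consChain_head_mem_degenerate (t : Fin (n + 1) → X) :
    consChain (t 0) t ∈ degenerate X (n + 2) :=
  single_mem_degenerate 0 1 rfl rfl

theorem consChain_mem_degenerate_of_tail (a : X) {t : Fin n → X} {i j : Fin n}
    (hij : j.val = i.val + 1) (ht : t i = t j) : consChain a t ∈ degenerate X (n + 1) :=
  single_mem_degenerate i.succ j.succ (by simp [hij]) (by simpa using ht)

end ConsChain

section HeadSum

variable {X : Type*} {n : ℕ}

/-- The operator on rack chains that replaces the first entry `a` of a tuple by the sum of the
elements of `F a`. -/
noncomputable def headSum (F : X → Finset X) : RackChain X (n + 1) →ₗ[ℤ] RackChain X (n + 1) :=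
  Finsupp.linearCombination ℤ fun x => ∑ z ∈ F (x 0), consChain z (Fin.tail x)

@[simp]
theorem headSum_consChain (F : X → Finset X) (a : X) (t : Fin n → X) :
    headSum F (consChain a t) = ∑ z ∈ F a, consChain z t := by
  simp [headSum, consChain]

theorem headSum_comp_headSum {F G : X → Finset X} {m : ℕ} (hFG : ∀ a, ∀ z ∈ G a, F z = F a)
    (hG : ∀ a, #(G a) = m) :
    headSum F ∘ₗ headSum G =
      ((m : ℤ) • headSum F : RackChain X (n + 1) →ₗ[ℤ] RackChain X (n + 1)) := by
  refine rackChain_hom_ext fun a t => ?_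
  calc headSum F (headSum G (consChain a t))
    _ = ∑ z ∈ G a, ∑ w ∈ F z, consChain w t := by simp only [headSum_consChain, map_sum]
    _ = ∑ _ ∈ G a, ∑ w ∈ F a, consChain w t := sum_congr rfl fun z hz => by rw [hFG a z hz]
    _ = (m : ℤ) • headSum F (consChain a t) := by
      rw [sum_const, hG, headSum_consChain, natCast_zsmul]

theorem rackBoundary_comp_headSum [Rack X] {F : X → Finset X}
    (hF : ∀ a c, F (op a c) = (F a).map (Rack.act' c).toEmbedding) :
    rackBoundary X (n + 1) ∘ₗ headSum F = headSum F ∘ₗ rackBoundary X (n + 1) := by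
  refine rackChain_hom_ext fun a t => ?_
  have sum_head_op (c : X) (s : Fin n → X) :
      headSum F (consChain (op a c) s) = ∑ z ∈ F a, consChain (op z c) s := by
    rw [headSum_consChain, hF, sum_map]
    rfl
  simp only [LinearMap.comp_apply, headSum_consChain, sum_head_op, rackBoundary_consChain, map_sum,
    map_smul, map_sub, ← sum_sub_distrib, smul_sum]
  exact sum_comm

end HeadSum

section RepeatSecond

variable {X : Type*}

/-- The operator on rack chains that replaces the first entry of a tuple by the second one,
`(a, b, t) ↦ (b, b, t)`. It is zero on tuples of length one, which makes it a chain map. -/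
noncomputable def repeatSecond : (n : ℕ) → RackChain X (n + 1) →ₗ[ℤ] RackChain X (n + 1)
  | 0 => 0
  | _ + 1 => Finsupp.lmapDomain ℤ ℤ fun x => Fin.cons (x 1) (Fin.tail x)

@[simp]
theorem repeatSecond_succ_consChain {n : ℕ} (a : X) (t : Fin (n + 1) → X) :
    repeatSecond (n + 1) (consChain a t) = consChain (t 0) t := by
  simp only [repeatSecond, consChain, Finsupp.lmapDomain_apply, Finsupp.mapDomain_single,
    Fin.cons_one, Fin.tail_cons]

theorem rackBoundary_comp_repeatSecond [Quandle X] (n : ℕ) :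
    rackBoundary X (n + 1) ∘ₗ repeatSecond (n + 1) =
      repeatSecond n ∘ₗ rackBoundary X (n + 1) := by
  refine rackChain_hom_ext fun a s => ?_
  cases s using Fin.consCases with | cons b t => ?_
  cases n with
  | zero =>
    rw [LinearMap.comp_apply, repeatSecond_succ_consChain, Fin.cons_zero,
      rackBoundary_one_consChain_cons, op, Quandle.fix, sub_self]
    rfl
  | succ n =>
    simp only [LinearMap.comp_apply, repeatSecond_succ_consChain, rackBoundary_consChain_cons,
      Fin.cons_zero, map_sub, map_sum, map_smul, sub_self, Quandle.fix]

theorem repeatSecond_mem_degenerate {n : ℕ} (c : RackChain X (n + 1)) :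
    repeatSecond n c ∈ degenerate X (n + 1) := by
  cases n with
  | zero => exact Submodule.zero_mem _
  | succ n =>
    have h : (degenerate X (n + 2)).mkQ ∘ₗ repeatSecond (n + 1) = 0 :=
      rackChain_hom_ext fun a t => by simpa using consChain_head_mem_degenerate t
    simpa using LinearMap.congr_fun h c

theorem headSum_comp_repeatSecond {n : ℕ} (s : Finset X) :
    headSum (fun _ => s) ∘ₗ repeatSecond (n + 1) = headSum fun _ => s :=
  rackChain_hom_ext fun a t => by simp

end RepeatSecond

section InsertSecond

variable {X : Type*} [Fintype X] {n : ℕ}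

/-- The operator `(a, t) ↦ ∑ y, (a, y, t)` on rack chains. -/
noncomputable def insertSecond : RackChain X (n + 1) →ₗ[ℤ] RackChain X (n + 2) :=
  Finsupp.linearCombination ℤ fun x => ∑ y, consChain (x 0) (Fin.cons y (Fin.tail x))

@[simp]
theorem insertSecond_consChain (a : X) (t : Fin n → X) :
    insertSecond (consChain a t) = ∑ y, consChain a (Fin.cons y t) := by
  simp [insertSecond, consChain]

theorem linearCombination_comp_augmentation :
    Finsupp.linearCombination ℤ (fun t : Fin 0 → X => ∑ z, consChain z t) ∘ₗ augmentation X =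
      headSum fun _ => univ :=
  rackChain_hom_ext fun a t => by simp [augmentation_consChain]

theorem rackBoundary_one_insertSecond [Shelf X] (a : X) (t : Fin 0 → X) :
    rackBoundary X 1 (insertSecond (consChain a t)) =
      ∑ y, (consChain a t - consChain (op a y) t) := by
  simp only [insertSecond_consChain, map_sum, rackBoundary_one_consChain_cons]

theorem rackBoundary_insertSecond [Rack X] (a : X) (t : Fin (n + 1) → X) :
    rackBoundary X (n + 2) (insertSecond (consChain a t)) +
        insertSecond (rackBoundary X (n + 1) (consChain a t)) =
      ∑ y, (consChain a t - consChain (op a y) t) := by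
  have insert_op (b c : X) (s : Fin n → X) :
      insertSecond (consChain b s) = ∑ y, consChain b (Fin.cons (op y c) s) := by
    rw [insertSecond_consChain]
    exact ((Rack.act' c).sum_comp fun y => consChain b (Fin.cons y s)).symm
  have insert_boundary : insertSecond (rackBoundary X (n + 1) (consChain a t)) =
      ∑ y, ∑ i : Fin (n + 1), (-1 : ℤ) ^ i.val • (consChain a (Fin.cons y (face₀ i t)) -
        consChain (op a (t i)) (Fin.cons (op y (t i)) (face i t))) := by
    rw [rackBoundary_consChain, sum_comm, map_sum]
    refine sum_congr rfl fun i _ => ?_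
    rw [map_smul, map_sub, insertSecond_consChain, insert_op _ (t i), ← sum_sub_distrib, smul_sum]
  simp only [insert_boundary, insertSecond_consChain, map_sum, rackBoundary_consChain_cons,
    ← sum_add_distrib, sub_add_cancel]

variable [Quandle X] [DecidableEq X] {m : ℕ}

theorem IsAlmostQuasigroup.sum_consChain_sub_op (hX : IsAlmostQuasigroup X m)
    (a : X) (t : Fin n → X) :
    ∑ y, (consChain a t - consChain (op a y) t) =
      (((Fintype.card X : ℤ) - m) • LinearMap.id + headSum stabilizerFinset -
        headSum fun _ => univ : RackChain X (n + 1) →ₗ[ℤ] RackChain X (n + 1))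
          (consChain a t) := by
  simp only [sum_sub_distrib, hX.sum_op a (consChain · t), sum_const, card_univ,
    LinearMap.sub_apply, LinearMap.add_apply, LinearMap.smul_apply, LinearMap.id_apply,
    headSum_consChain]
  module

theorem IsAlmostQuasigroup.rackBoundary_comp_insertSecond_zero (hX : IsAlmostQuasigroup X m) :
    rackBoundary X 1 ∘ₗ insertSecond =
      ((Fintype.card X : ℤ) - m) • LinearMap.id + headSum stabilizerFinset -
        headSum fun _ => univ :=
  rackChain_hom_ext fun a t =>
    (rackBoundary_one_insertSecond a t).trans (hX.sum_consChain_sub_op a t)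

theorem IsAlmostQuasigroup.rackBoundary_comp_insertSecond_succ (hX : IsAlmostQuasigroup X m) :
    rackBoundary X (n + 2) ∘ₗ insertSecond + insertSecond ∘ₗ rackBoundary X (n + 1) =
      ((Fintype.card X : ℤ) - m) • LinearMap.id + headSum stabilizerFinset -
        headSum fun _ => univ :=
  rackChain_hom_ext fun a t =>
    (rackBoundary_insertSecond a t).trans (hX.sum_consChain_sub_op a t)

end InsertSecond

section NullHomotopy

variable {X : Type*} [Quandle X] [Fintype X] [DecidableEq X]

/-- The operator `|X| - S` on rack chains, where `S` sums over the stabilizer set of the first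
entry. -/
noncomputable def cardSubStabilizer (n : ℕ) : RackChain X (n + 1) →ₗ[ℤ] RackChain X (n + 1) :=
  (Fintype.card X : ℤ) • LinearMap.id - headSum stabilizerFinset

theorem rackBoundary_comp_cardSubStabilizer (n : ℕ) :
    rackBoundary X (n + 1) ∘ₗ cardSubStabilizer (n + 1) =
      cardSubStabilizer n ∘ₗ rackBoundary X (n + 1) := by
  simp only [cardSubStabilizer, LinearMap.comp_sub, LinearMap.sub_comp, LinearMap.comp_smul,
    LinearMap.smul_comp, LinearMap.comp_id, LinearMap.id_comp,
    rackBoundary_comp_headSum stabilizerFinset_op]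

theorem IsAlmostQuasigroup.smul_id_add_headSum_sub_headSum_comp_cardSubStabilizer
    {m : ℕ} (hX : IsAlmostQuasigroup X m) (hS : ∀ a : X, IsTrivialSubquandle (stabilizerSet a))
    (n : ℕ) :
    (((Fintype.card X : ℤ) - m) • LinearMap.id + headSum stabilizerFinset -
        headSum fun _ => univ) ∘ₗ cardSubStabilizer n =
      ((Fintype.card X : ℤ) - m) •
        ((Fintype.card X : ℤ) • LinearMap.id - headSum fun _ : X => univ) := by
  simp only [cardSubStabilizer, LinearMap.comp_sub, LinearMap.sub_comp, LinearMap.add_comp,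
    LinearMap.comp_smul, LinearMap.smul_comp, LinearMap.comp_id, LinearMap.id_comp,
    headSum_comp_headSum (stabilizerFinset_eq_of_mem hS) hX.card_stabilizerFinset,
    headSum_comp_headSum (F := fun _ => univ) (fun _ _ _ => rfl) hX.card_stabilizerFinset]
  module

variable (X) in
/-- The contraction, modulo degenerate chains, of the multiplication by `|X| (|X| - m)` on the
reduced complex. -/
noncomputable def nullHomotopy (m : ℕ) : (n : ℕ) → RackChain X n →ₗ[ℤ] RackChain X (n + 1)
  | 0 => ((Fintype.card X : ℤ) - m) • Finsupp.linearCombination ℤ fun t => ∑ z, consChain z t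
  | n + 1 => insertSecond ∘ₗ cardSubStabilizer n ∘ₗ (LinearMap.id - repeatSecond n)

theorem insertSecond_cardSubStabilizer_mem_degenerate {n : ℕ} (a : X) {t : Fin n → X} {i j : Fin n}
    (hij : j.val = i.val + 1) (ht : t i = t j) :
    insertSecond (cardSubStabilizer n (consChain a t)) ∈ degenerate X (n + 2) := by
  have insert_mem (b : X) : insertSecond (consChain b t) ∈ degenerate X (n + 2) := by
    rw [insertSecond_consChain]
    exact Submodule.sum_mem _ fun y _ => consChain_mem_degenerate_of_tail b
      (i := i.succ) (j := j.succ) (by simp [hij]) (by simpa using ht)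
  simp only [cardSubStabilizer, LinearMap.sub_apply, LinearMap.smul_apply, LinearMap.id_apply,
    headSum_consChain, map_sub, map_smul, map_sum]
  exact Submodule.sub_mem _ (Submodule.smul_mem _ _ (insert_mem a))
    (Submodule.sum_mem _ fun z _ => insert_mem z)

theorem nullHomotopy_degenerate (m n : ℕ) :
    degenerate X n ≤ (degenerate X (n + 1)).comap (nullHomotopy X m n) := by
  rw [degenerate, Submodule.span_le]
  rintro _ ⟨x, ⟨i, j, hij, hx⟩, rfl⟩
  match n with
  | 0 => exact i.elim0
  | 1 => omega
  | n + 2 =>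
    cases x using Fin.consCases with | cons a t => ?_
    have apply_cons : nullHomotopy X m (n + 2) (consChain a t) =
        insertSecond (cardSubStabilizer (n + 1) (consChain a t - consChain (t 0) t)) := by
      rw [← repeatSecond_succ_consChain a t]
      rfl
    change nullHomotopy X m (n + 2) (consChain a t) ∈ degenerate X (n + 3)
    rw [apply_cons]
    cases j using Fin.cases with
    | zero => simp at hij
    | succ j =>
    cases i using Fin.cases with
    | zero =>
      obtain rfl : j = 0 := Fin.ext (by simpa using hij)
      obtain rfl : a = t 0 := hx
      simp
    | succ i =>
      rw [map_sub, map_sub]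
      have mem (b : X) := insertSecond_cardSubStabilizer_mem_degenerate b
        (t := t) (i := i) (j := j) (by simpa using hij) (by simpa using hx)
      exact Submodule.sub_mem _ (mem a) (mem (t 0))

theorem reducedBoundary_comp_nullHomotopy_zero (m : ℕ) :
    reducedBoundary X 0 ∘ₗ nullHomotopy X m 0 =
      ((Fintype.card X : ℤ) * (Fintype.card X - m)) • LinearMap.id := by
  refine Finsupp.lhom_ext' fun t => LinearMap.ext_ring ?_
  simp only [LinearMap.comp_apply, Finsupp.lsingle_apply, LinearMap.smul_apply, LinearMap.id_apply,
    reducedBoundary, nullHomotopy, Finsupp.linearCombination_single, one_smul, map_smul, map_sum]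
  rw [sum_congr rfl fun z _ => augmentation_consChain z t, sum_const, card_univ]
  module

theorem IsAlmostQuasigroup.reducedBoundary_comp_nullHomotopy_succ {m : ℕ}
    (hX : IsAlmostQuasigroup X m) (hS : ∀ a : X, IsTrivialSubquandle (stabilizerSet a)) (n : ℕ) :
    reducedBoundary X (n + 1) ∘ₗ nullHomotopy X m (n + 1) +
        nullHomotopy X m n ∘ₗ reducedBoundary X n =
      ((Fintype.card X : ℤ) * (Fintype.card X - m)) • (LinearMap.id - repeatSecond n) := by
  cases n with
  | zero =>
    simp only [reducedBoundary, nullHomotopy, repeatSecond, sub_zero, LinearMap.comp_id,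
      ← LinearMap.comp_assoc, hX.rackBoundary_comp_insertSecond_zero,
      hX.smul_id_add_headSum_sub_headSum_comp_cardSubStabilizer hS, LinearMap.smul_comp]
    rw [linearCombination_comp_augmentation]
    module
  | succ n =>
    calc rackBoundary X (n + 2) ∘ₗ insertSecond ∘ₗ cardSubStabilizer (n + 1) ∘ₗ
            (LinearMap.id - repeatSecond (n + 1)) +
          (insertSecond ∘ₗ cardSubStabilizer n ∘ₗ (LinearMap.id - repeatSecond n)) ∘ₗ
            rackBoundary X (n + 1)
      _ = ((rackBoundary X (n + 2) ∘ₗ insertSecond + insertSecond ∘ₗ rackBoundary X (n + 1)) ∘ₗ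
            cardSubStabilizer (n + 1)) ∘ₗ (LinearMap.id - repeatSecond (n + 1)) := by
        have repeat_comm : (LinearMap.id - repeatSecond n) ∘ₗ rackBoundary X (n + 1) =
            rackBoundary X (n + 1) ∘ₗ (LinearMap.id - repeatSecond (n + 1)) := by
          rw [LinearMap.sub_comp, LinearMap.comp_sub, rackBoundary_comp_repeatSecond,
            LinearMap.id_comp, LinearMap.comp_id]
        simp only [LinearMap.add_comp, LinearMap.comp_assoc, repeat_comm]
        simp only [← LinearMap.comp_assoc, rackBoundary_comp_cardSubStabilizer]
      _ = ((Fintype.card X : ℤ) * (Fintype.card X - m)) •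
            (LinearMap.id - repeatSecond (n + 1)) := by
        rw [hX.rackBoundary_comp_insertSecond_succ,
          hX.smul_id_add_headSum_sub_headSum_comp_cardSubStabilizer hS]
        simp only [LinearMap.comp_sub, LinearMap.sub_comp, LinearMap.smul_comp,
          LinearMap.comp_id, LinearMap.id_comp, headSum_comp_repeatSecond]
        module

end NullHomotopy

section Homology

open CategoryTheory

theorem zsmul_homology_eq_zero_of_homotopy {R ι : Type*} [Ring R] {c : ComplexShape ι}
    {K : HomologicalComplex (ModuleCat R) c} {r : ℤ} (h : Homotopy (r • 𝟙 K) 0) (i : ι)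
    (z : K.homology i) : r • z = 0 := by
  have homologyMap_zsmul_id :
      HomologicalComplex.homologyMap (r • 𝟙 K) i = r • 𝟙 (K.homology i) := by
    rw [← HomologicalComplex.homologyMap_id]
    exact (HomologicalComplex.homologyFunctor _ c i).map_zsmul
  have zsmul_id : r • 𝟙 (K.homology i) = 0 := by
    rw [← homologyMap_zsmul_id, h.homologyMap_eq, HomologicalComplex.homologyMap_zero]
  exact ConcreteCategory.congr_hom zsmul_id z

variable {X : Type*} [Quandle X] [Fintype X] [DecidableEq X]

variable (X) in
/-- The map induced by `nullHomotopy` on quandle chains. -/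
noncomputable def quandleNullHomotopy (m n : ℕ) :
    QuandleChain X n →ₗ[ℤ] QuandleChain X (n + 1) :=
  Submodule.mapQ _ _ (nullHomotopy X m n) (nullHomotopy_degenerate m n)

theorem reducedQuandleBoundary_comp_quandleNullHomotopy_zero (m : ℕ) :
    reducedQuandleBoundary X 0 ∘ₗ quandleNullHomotopy X m 0 =
      ((Fintype.card X : ℤ) * (Fintype.card X - m)) • LinearMap.id := by
  refine Submodule.linearMap_qext _ (LinearMap.ext fun c => ?_)
  exact congrArg Submodule.Quotient.mk
    (LinearMap.congr_fun (reducedBoundary_comp_nullHomotopy_zero m) c)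

theorem IsAlmostQuasigroup.reducedQuandleBoundary_comp_quandleNullHomotopy_succ {m : ℕ}
    (hX : IsAlmostQuasigroup X m) (hS : ∀ a : X, IsTrivialSubquandle (stabilizerSet a)) (n : ℕ) :
    reducedQuandleBoundary X (n + 1) ∘ₗ quandleNullHomotopy X m (n + 1) +
        quandleNullHomotopy X m n ∘ₗ reducedQuandleBoundary X n =
      ((Fintype.card X : ℤ) * (Fintype.card X - m)) • LinearMap.id := by
  refine Submodule.linearMap_qext _ (LinearMap.ext fun c => ?_)
  have h := congrArg (degenerate X (n + 1)).mkQ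
    (LinearMap.congr_fun (hX.reducedBoundary_comp_nullHomotopy_succ hS n) c)
  have repeat_eq_zero : (degenerate X (n + 1)).mkQ (repeatSecond n c) = 0 :=
    (Submodule.Quotient.mk_eq_zero _).2 (repeatSecond_mem_degenerate c)
  simp only [LinearMap.smul_apply, LinearMap.sub_apply, map_smul, map_sub, repeat_eq_zero,
    sub_zero] at h
  exact h

/-- The contraction of the multiplication by `|X| (|X| - m)` on the reduced quandle complex. -/
noncomputable def IsAlmostQuasigroup.smulIdHomotopyZero {m : ℕ} (hX : IsAlmostQuasigroup X m)
    (hS : ∀ a : X, IsTrivialSubquandle (stabilizerSet a)) :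
    Homotopy (((Fintype.card X : ℤ) * (Fintype.card X - m)) • 𝟙 (reducedQuandleComplex X)) 0 :=
  let s (i j : ℕ) (hij : (ComplexShape.down ℕ).Rel j i) :
      (reducedQuandleComplex X).X i ⟶ (reducedQuandleComplex X).X j :=
    match j, hij with
    | _, rfl => ModuleCat.ofHom (quandleNullHomotopy X m i)
  have smul_id_eq_nullHomotopicMap :
      ((Fintype.card X : ℤ) * (Fintype.card X - m)) • 𝟙 (reducedQuandleComplex X) =
        Homotopy.nullHomotopicMap' s := by
    ext n : 1
    cases n with
    | zero =>
      rw [Homotopy.nullHomotopicMap'_f_of_not_rel_left (k₁ := 1) rfl (by simp),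
        reducedQuandleComplex_d]
      exact congrArg ModuleCat.ofHom
        (reducedQuandleBoundary_comp_quandleNullHomotopy_zero m).symm
    | succ n =>
      rw [Homotopy.nullHomotopicMap'_f (k₂ := n + 2) (k₀ := n) rfl rfl]
      simp only [reducedQuandleComplex_d]
      exact congrArg ModuleCat.ofHom <| ((add_comm _ _).trans
        (hX.reducedQuandleBoundary_comp_quandleNullHomotopy_succ hS n)).symm
  (Homotopy.ofEq smul_id_eq_nullHomotopicMap).trans (Homotopy.nullHomotopy' s)

end Homology

theorem mul_sub_dvd_mul_lcm {k m : ℕ} (h : m ≤ k) : k * (k - m) ∣ m * Nat.lcm k (k - m) := by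
  have gcd_dvd : Nat.gcd k (k - m) ∣ m := by
    simpa only [Nat.sub_sub_self h] using
      Nat.dvd_sub (Nat.gcd_dvd_left k (k - m)) (Nat.gcd_dvd_right k (k - m))
  rw [← Nat.gcd_mul_lcm k (k - m)]
  exact Nat.mul_dvd_mul_right gcd_dvd _

theorem IsAlmostQuasigroup.card_mul_card_sub_smul_eq_zero {X : Type*} [Quandle X] [Finite X]
    {m : ℕ} (hX : IsAlmostQuasigroup X m)
    (hS : ∀ a : X, IsTrivialSubquandle (stabilizerSet a)) {n : ℕ}
    (z : ReducedQuandleHomology X n) : ((Nat.card X : ℤ) * (Nat.card X - m)) • z = 0 := by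
  classical
  have := Fintype.ofFinite X
  rw [Nat.card_eq_fintype_card]
  exact zsmul_homology_eq_zero_of_homotopy (hX.smulIdHomotopyZero hS) n z

end QuandleHomology

theorem corollary3p3 {X : Type*} [Quandle X] [Finite X] (m : ℕ)
    (hX : QuandleHomology.IsAlmostQuasigroup X m)
    (hS : ∀ a : X, QuandleHomology.IsTrivialSubquandle (QuandleHomology.stabilizerSet a))
    (hnt : ¬ QuandleHomology.IsTrivialQuandle X)
    (n : ℕ) (z : QuandleHomology.ReducedQuandleHomology X n) :
    (m * Nat.lcm (Nat.card X) (Nat.card X - m)) • z = 0 := by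
  have : Nonempty X := (not_forall.1 hnt).nonempty
  have hm : m ≤ Nat.card X := hX.le_card
  have hz : (Nat.card X * (Nat.card X - m)) • z = 0 := by
    rw [← natCast_zsmul, Nat.cast_mul, Nat.cast_sub hm]
    exact hX.card_mul_card_sub_smul_eq_zero hS z
  obtain ⟨l, hl⟩ := QuandleHomology.mul_sub_dvd_mul_lcm hm
  rw [hl, mul_comm, mul_smul, hz, smul_zero]
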